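/- Let $d\ge 1$ and $x_0\in(0,1)^d$. A smoothness level is $\alpha=(\alpha_1,\dots,\alpha_d)$ for which there is $0\le s\le d$ such that $\alpha_1,\dots,\alpha_s$ are positive integers and $\alpha_{s+1}=\dots=\alpha_d=\infty$. The design is either a fixed lattice with parameters $\beta_k>0$, $\sum_{k=1}^d\beta_k=1$, or uniform random on $[0,1]^d$. The critical index $\kappa_*\in\{1,\dots,d\}$ is the unique maximiser of $\ell\mapsto \big(\sum_{k=\ell}^d\beta_k\big)/\big(2+\sum_{k=\ell}^s\alpha_k^{-1}\big)$ for the lattice design (assumed to be unique), and $\kappa_*=1$ for the random design. Let $\mathbb G$ be a centred Gaussian process on $\mathbb R_{\ge0}^d\times\mathbb R_{\ge0}^d$ with almost surely continuous sample paths and $$\mathrm{Cov}\big(\mathbb G(g_1,g_2),\mathbb G(g_1',g_2')\big)=\prod_{k=\kappa_*}^d\big((g_1)_k\wedge(g_1')_k+(g_2)_k\wedge(g_2')_k\big).$$ Put $\mathscr G_1=\{g>0: g_k\le (x_0)_k,\ s<k\le d\}$, $\mathscr G_2=\{g>0: g_k\le (1-x_0)_k,\ s<k\le d\}$, where $g>0$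 is meant coordinatewise, $$\mathbb V_\alpha(g_1,g_2)=\frac{\mathbb G(g_1,g_2)}{\prod_{k=\kappa_*}^d\big((g_1)_k+(g_2)_k\big)}+\sum_{k=\kappa_*}^s\frac{(g_2)_k^{\alpha_k+1}-(g_1)_k^{\alpha_k+1}}{(g_2)_k+(g_1)_k},$$ $$\mathbb V_\alpha^-=\sup_{g_1\in\mathscr G_1}\inf_{g_2\in\mathscr G_2}\mathbb V_\alpha(g_1,g_2),\qquad \mathbb V_\alpha^+=\inf_{g_2\in\mathscr G_2}\sup_{g_1\in\mathscr G_1}\mathbb V_\alpha(g_1,g_2)$$ (empty sums are $0$ and empty products are $1$). Let $g_1^*\in\mathscr G_1$ and $g_2^*\in\mathscr G_2$ be such that $\inf_{g_2\in\mathscr G_2}\mathbb V_\alpha(g_1^*,g_2)=\mathbb V_\alpha^-$ and $\sup_{g_1\in\mathscr G_1}\mathbb V_\alpha(g_1,g_2^*)=\mathbb V_\alpha^+$, and let $$\mathbb L_\alpha=\sqrt{\prod_{k=\kappa_*}^s(g_1^*+g_2^*)_k}\;\cdot\;\frac{\mathbb V_\alpha^-+\mathbb V_\alpha^+}{2}.$$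 (Almost surely such $g_1^*,g_2^*$ exist and are unique in the coordinates $k\ge\kappa_*$, the only ones that matter. The event $\{|\mathbb L_\alpha|>t\}$ below is read as the event that some such pair $(g_1^*,g_2^*)$ gives a value of absolute value larger than $t$; its outer probability is bounded.) 1. There is a constant $L_0>0$ depending only on $d$ and $x_0$ such that for all $t\ge1$, all smoothness levels $\alpha$ and all designs with critical index $\kappa_*$, $$\mathbb P\big(|\mathbb L_\alpha|>t\big)\le L_0\exp\big(-t^{4/(d+2)}/L_0\big).$$ 2. Consequently, for every $\delta_0\in(0,1)$ there is a constant $C>0$ depending only on $d$, $x_0$ and $\delta_0$ such that for all $\delta\in(0,\delta_0]$ the critical value $c_\delta=C\log^{(d+2)/4}(1/\delta)$ satisfies $\mathbb P(|\mathbb L_\alpha|>c_\delta)\le\delta$ for all smoothness levels $\alpha$ and all designs with critical index $\kappa_*$. -/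

import Mathlib

open MeasureTheory ProbabilityTheory
open scoped NNReal ENNReal

universe u

noncomputable section

namespace BlockIsotonic

/-- A local smoothness level `α = (α_1, …, α_d)` with intrinsic dimension `s`: the first `s`
exponents are positive integers, the remaining ones are infinite. -/
structure Smoothness (d : ℕ) where
  /-- the intrinsic dimension -/
  s : ℕ
  s_le : s ≤ d
  /-- the exponents `α_k` -/
  exponent : Fin d → ℕ∞
  one_le : ∀ k, 1 ≤ exponent k
  lt_top_iff : ∀ k, exponent k < ⊤ ↔ (k : ℕ) < s

/-- The type of the design: a fixed lattice with about `n ^ β_k` points in direction `k`,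
where `β_k > 0` and `∑ β_k = 1`, or the uniform random design. -/
inductive Design (d : ℕ) where
  | lattice (β : Fin d → ℝ) (pos : ∀ k, 0 < β k) (sum_eq_one : ∑ k, β k = 1) : Design d
  | random : Design d

variable {d : ℕ}

/-- The coordinates `κ ≤ k ≤ d`. -/
def upperCoords (κ : Fin d) : Finset (Fin d) := Finset.univ.filter fun k => κ ≤ k

/-- The coordinates `κ ≤ k ≤ s`. -/
def activeCoords (α : Smoothness d) (κ : Fin d) : Finset (Fin d) :=
  Finset.univ.filter fun k => κ ≤ k ∧ (k : ℕ) < α.s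

/-- The finite exponents as natural numbers (used for the first `s` coordinates only). -/
def Smoothness.exp (α : Smoothness d) (k : Fin d) : ℕ := (α.exponent k).toNat

/-- The criterion `(∑_{k = ℓ}^d β_k) / (2 + ∑_{k = ℓ}^s 1 / α_k)`. -/
def latticeCriterion (β : Fin d → ℝ) (α : Smoothness d) (l : Fin d) : ℝ :=
  (∑ k ∈ upperCoords l, β k) / (2 + ∑ k ∈ activeCoords α l, ((α.exp k : ℝ))⁻¹)

/-- `κ` is the critical index `κ_*` of the design at smoothness `α`: the unique maximiser of the
criterion for a lattice design, and the first index for a random design. -/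
def IsCriticalIndex (α : Smoothness d) (κ : Fin d) : Design d → Prop
  | .lattice β _ _ => ∀ l, l ≠ κ → latticeCriterion β α l < latticeCriterion β α κ
  | .random => (κ : ℕ) = 0

/-- Points of `[0, ∞)^d`. -/
abbrev Orthant (d : ℕ) : Type := Fin d → ℝ≥0

/-- A version with almost surely continuous sample paths of the centred Gaussian process `𝔾`
on `[0, ∞)^d × [0, ∞)^d` with covariance
`∏_{k = κ}^d ((g₁)_k ∧ (g₁')_k + (g₂)_k ∧ (g₂')_k)`. -/
structure IsNoise {Ω : Type*} [MeasurableSpace Ω] (P : Measure Ω) (κ : Fin d)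
    (G : Orthant d × Orthant d → Ω → ℝ) : Prop where
  gaussian : IsGaussianProcess G P
  centered : ∀ g, ∫ ω, G g ω ∂P = 0
  covariance_eq : ∀ g g', cov[G g, G g'; P] =
    ∏ k ∈ upperCoords κ, ((min (g.1 k) (g'.1 k) + min (g.2 k) (g'.2 k) : ℝ≥0) : ℝ)
  continuous_paths : ∀ᵐ ω ∂P, Continuous fun g => G g ω

/-- `𝒢₁ = {g > 0 : g_k ≤ (x₀)_k for s < k ≤ d}`. -/
def G1 (x₀ : Fin d → ℝ) (α : Smoothness d) : Set (Orthant d) :=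
  {g | (∀ k, 0 < g k) ∧ ∀ k : Fin d, α.s ≤ (k : ℕ) → (g k : ℝ) ≤ x₀ k}

/-- `𝒢₂ = {g > 0 : g_k ≤ (1 - x₀)_k for s < k ≤ d}`. -/
def G2 (x₀ : Fin d → ℝ) (α : Smoothness d) : Set (Orthant d) :=
  {g | (∀ k, 0 < g k) ∧ ∀ k : Fin d, α.s ≤ (k : ℕ) → (g k : ℝ) ≤ 1 - x₀ k}

/-- `𝕍_α(g₁, g₂)`, for one sample path `γ` of `𝔾`. -/
def V (α : Smoothness d) (κ : Fin d) (γ : Orthant d × Orthant d → ℝ) (g₁ g₂ : Orthant d) : ℝ :=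
  γ (g₁, g₂) / ∏ k ∈ upperCoords κ, ((g₁ k : ℝ) + g₂ k) +
    ∑ k ∈ activeCoords α κ,
      ((g₂ k : ℝ) ^ (α.exp k + 1) - (g₁ k : ℝ) ^ (α.exp k + 1)) / ((g₂ k : ℝ) + g₁ k)

/-- `sup_{g₁ ∈ 𝒢₁} inf_{g₂ ∈ 𝒢₂} 𝕍_α(g₁, g₂)`, as an extended real number. -/
def VSupInf (x₀ : Fin d → ℝ) (α : Smoothness d) (κ : Fin d)
    (γ : Orthant d × Orthant d → ℝ) : EReal :=
  ⨆ g₁ ∈ G1 x₀ α, ⨅ g₂ ∈ G2 x₀ α, (V α κ γ g₁ g₂ : EReal)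

/-- `inf_{g₂ ∈ 𝒢₂} sup_{g₁ ∈ 𝒢₁} 𝕍_α(g₁, g₂)`, as an extended real number. -/
def VInfSup (x₀ : Fin d → ℝ) (α : Smoothness d) (κ : Fin d)
    (γ : Orthant d × Orthant d → ℝ) : EReal :=
  ⨅ g₂ ∈ G2 x₀ α, ⨆ g₁ ∈ G1 x₀ α, (V α κ γ g₁ g₂ : EReal)

/-- `(g₁, g₂)` is a pair `(g₁*, g₂*)`: `g₁ ∈ 𝒢₁` attains the outer supremum in `sup inf 𝕍_α`
and `g₂ ∈ 𝒢₂` attains the outer infimum in `inf sup 𝕍_α`. -/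
structure IsOptimalPair (x₀ : Fin d → ℝ) (α : Smoothness d) (κ : Fin d)
    (γ : Orthant d × Orthant d → ℝ) (g₁ g₂ : Orthant d) : Prop where
  mem₁ : g₁ ∈ G1 x₀ α
  mem₂ : g₂ ∈ G2 x₀ α
  attains₁ : (⨅ g ∈ G2 x₀ α, (V α κ γ g₁ g : EReal)) = VSupInf x₀ α κ γ
  attains₂ : (⨆ g ∈ G1 x₀ α, (V α κ γ g g₂ : EReal)) = VInfSup x₀ α κ γ

/-- `𝕊_α(g₁, g₂) = (∏_{k = κ}^s (g₁ + g₂)_k)^{1/2}`. -/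
def S (α : Smoothness d) (κ : Fin d) (g₁ g₂ : Orthant d) : ℝ :=
  Real.sqrt (∏ k ∈ activeCoords α κ, ((g₂ k : ℝ) + g₁ k))

/-- The value `𝕊_α(g₁, g₂) · (sup inf 𝕍_α + inf sup 𝕍_α) / 2` for one sample path `γ` of `𝔾`;
at an optimal pair this is the value of `𝕃_α`. -/
def limitValue (x₀ : Fin d → ℝ) (α : Smoothness d) (κ : Fin d)
    (γ : Orthant d × Orthant d → ℝ) (g₁ g₂ : Orthant d) : EReal :=
  ((S α κ g₁ g₂ * (1 / 2) : ℝ) : EReal) * (VSupInf x₀ α κ γ + VInfSup x₀ α κ γ)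

/-- The event `|𝕃_α| > t`: some optimal pair `(g₁*, g₂*)` gives a value of `𝕃_α` whose absolute
value (possibly infinite) exceeds `t`. Almost surely optimal pairs exist and are unique in the
coordinates `k ≥ κ`, the only ones that enter the value; taking all optimal pairs avoids any
choice on the exceptional null set and dominates every measurable selection. -/
def exceedance {Ω : Type*} (x₀ : Fin d → ℝ) (α : Smoothness d) (κ : Fin d)
    (G : Orthant d × Orthant d → Ω → ℝ) (t : ℝ) : Set Ω :=
  {ω | ∃ g₁ g₂, IsOptimalPair x₀ α κ (fun g => G g ω) g₁ g₂ ∧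
    ENNReal.ofReal t < (limitValue x₀ α κ (fun g => G g ω) g₁ g₂).abs}

end BlockIsotonic

end

/-!
Freeze the second argument of the noise at a corner `b` of the box `∏ (0, 1 - (x₀)_k]`. The
normalised noise `g ↦ 𝔾(g, b) / ∏ (g + b)` has covariance `∏ (g ⊔ g' + b)⁻¹`, a function of
`g ⊔ g'` only: it is a Brownian sheet whose time runs downwards. Its law is therefore invariant
under reflections in each coordinate, and Lévy's inequality bounds the tail of its supremum by
`2 ^ d` times the Gaussian tail at the origin. The same holds with the two arguments exchanged.

On the event that both frozen sections are bounded by `u`, testing the sup-inf and the inf-sup at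
the two corners gives `|𝕍_α^±| ≤ u + d`. As `α_k ≥ 1`, the bias grows at least linearly in each
active coordinate, so optimal pairs satisfy `g₁* + g₂* ≤ 4 (u + d + 1)` in the active coordinates.
Hence `|𝕃_α| ≤ (4 (u + d + 1)) ^ ((d + 2) / 2)`, and the Gaussian tail in `u` becomes
the tail `exp (-t ^ (4 / (d + 2)) / L₀)`.
-/

namespace BlockIsotonic

section GaussianFamily

variable {Ω T : Type*} [MeasurableSpace Ω] {P : Measure Ω}

theorem variance_dual_apply [Fintype T] [DecidableEq T] [IsFiniteMeasure P] {X : Ω → T → ℝ}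
    (hX : ∀ t, MemLp (fun ω => X ω t) 2 P) (L : StrongDual ℝ (T → ℝ)) :
    Var[fun ω => L (X ω); P] = ∑ s, ∑ t, L (Pi.single s 1) * (L (Pi.single t 1) *
      cov[fun ω => X ω s, fun ω => X ω t; P]) := by
  have hsum : (fun ω => L (X ω)) = fun ω => ∑ t, L (Pi.single t 1) * X ω t := by
    funext ω
    conv_lhs => rw [pi_eq_sum_univ' (X ω), map_sum]
    exact Finset.sum_congr rfl fun t _ => by rw [map_smul, smul_eq_mul, mul_comm]
  have hmul : ∀ t, MemLp (fun ω => L (Pi.single t 1) * X ω t) 2 P := fun t => (hX t).const_mul _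
  rw [hsum, ← covariance_self (memLp_finsetSum _ fun t _ => hmul t).aemeasurable,
    covariance_fun_sum_fun_sum hmul hmul]
  simp_rw [covariance_const_mul_left, covariance_const_mul_right]

theorem map_eq_of_hasGaussianLaw_pi [Finite T] {X Y : Ω → T → ℝ} (hX : HasGaussianLaw X P)
    (hY : HasGaussianLaw Y P) (hmean : ∀ t, ∫ ω, X ω t ∂P = ∫ ω, Y ω t ∂P)
    (hcov : ∀ s t, cov[fun ω => X ω s, fun ω => X ω t; P] =
      cov[fun ω => Y ω s, fun ω => Y ω t; P]) :
    P.map X = P.map Y := by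
  classical
  have := Fintype.ofFinite T
  have := hX.isProbabilityMeasure
  have := hX.isGaussian_map
  have := hY.isGaussian_map
  refine Measure.ext_of_charFunDual (funext fun L => ?_)
  have hintegral : ∫ ω, X ω ∂P = ∫ ω, Y ω ∂P := funext fun t => by
    rw [eval_integral fun t => (hX.eval t).integrable,
      eval_integral fun t => (hY.eval t).integrable, hmean]
  rw [hX.charFunDual_map_eq_fun, hY.charFunDual_map_eq_fun, L.integral_comp_comm hX.integrable,
    L.integral_comp_comm hY.integrable, hintegral,
    variance_dual_apply fun t => (hX.eval t).memLp_two,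
    variance_dual_apply fun t => (hY.eval t).memLp_two]
  simp_rw [hcov]

theorem aemeasurable_path [Countable T] {X : T → Ω → ℝ} (hX : IsGaussianProcess X P) :
    AEMeasurable (fun ω t => X t ω) P :=
  aemeasurable_pi_lambda _ hX.aemeasurable

theorem map_path_eq_of_covariance_eq [Countable T] {X Y : T → Ω → ℝ} (hX : IsGaussianProcess X P)
    (hY : IsGaussianProcess Y P) (hmean : ∀ t, ∫ ω, X t ω ∂P = ∫ ω, Y t ω ∂P)
    (hcov : ∀ s t, cov[X s, X t; P] = cov[Y s, Y t; P]) :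
    P.map (fun ω t => X t ω) = P.map (fun ω t => Y t ω) := by
  have := hX.isProbabilityMeasure
  exact (map_eq_iff_forall_finset_map_restrict_eq (aemeasurable_path hX)
    (aemeasurable_path hY)).2 fun I => map_eq_of_hasGaussianLaw_pi (hX.hasGaussianLaw I)
      (hY.hasGaussianLaw I) (fun t => hmean t) fun s t => hcov s t

theorem hasSubgaussianMGF_of_hasGaussianLaw {X : Ω → ℝ} (hX : HasGaussianLaw X P)
    (hmean : ∫ ω, X ω ∂P = 0) : HasSubgaussianMGF X Var[X; P].toNNReal P := by
  have hlaw : P.map X = gaussianReal 0 Var[X; P].toNNReal := hmean ▸ hX.map_eq_gaussianReal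
  refine ⟨fun t => ?_, fun t => ?_⟩
  · have hint := integrable_exp_mul_gaussianReal (μ := 0) (v := Var[X; P].toNNReal) t
    rw [← hlaw] at hint
    exact hint.comp_aemeasurable hX.aemeasurable
  · rw [mgf_gaussianReal hlaw, zero_mul, zero_add]

theorem measure_lt_abs_le_two_mul_exp {X : Ω → ℝ} {c : ℝ≥0} (hX : HasSubgaussianMGF X c P) {u : ℝ}
    (hu : 0 ≤ u) : P {ω | u < |X ω|} ≤ 2 * ENNReal.ofReal (Real.exp (-u ^ 2 / (2 * c))) := by
  have : IsFiniteMeasure P := by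
    simpa [integrable_const_iff] using hX.integrable_exp_mul 0
  have one_sided : ∀ Y, HasSubgaussianMGF Y c P →
      P {ω | u ≤ Y ω} ≤ ENNReal.ofReal (Real.exp (-u ^ 2 / (2 * c))) := fun Y hY =>
    (ENNReal.le_ofReal_iff_toReal_le (measure_ne_top _ _) (Real.exp_nonneg _)).2
      (hY.measure_ge_le hu)
  have hcover : {ω | u < |X ω|} ⊆ {ω | u ≤ X ω} ∪ {ω | u ≤ (-X) ω} := fun ω hω =>
    (lt_abs.1 (Set.mem_ofPred_eq ▸ hω)).imp le_of_lt le_of_lt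
  rw [two_mul]
  exact (measure_mono hcover).trans ((measure_union_le _ _).trans
    (add_le_add (one_sided X hX) (one_sided _ hX.neg)))

end GaussianFamily

section Reflection

variable {Ω I : Type*} [MeasurableSpace Ω] {P : Measure Ω} [SemilatticeSup I]

/-- The reflection of a path `x` beyond the point `a`: the values at points above `a` are kept and
the sign of each increment `x p - x (p ⊔ a)` is changed. It is used on laws with covariances
`f (p ⊔ q)`, where time runs downwards. -/
def reflect (a : I) (x : I → ℝ) (p : I) : ℝ := 2 * x (p ⊔ a) - x p

theorem reflect_apply_of_le {a p : I} (h : a ≤ p) (x : I → ℝ) : reflect a x p = x p := by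
  rw [reflect, sup_eq_left.2 h]
  ring

theorem measurable_reflect (a : I) : Measurable (reflect a) := by
  unfold reflect
  fun_prop

theorem isGaussianProcess_reflect {X : I → Ω → ℝ} (hX : IsGaussianProcess X P) (a : I) :
    IsGaussianProcess (fun p ω => reflect a (fun q => X q ω) p) P := by
  classical
  refine hX.of_isGaussianProcess fun p => ⟨{p ⊔ a, p},
    (2 : ℝ) • ContinuousLinearMap.proj ⟨p ⊔ a, by simp⟩ - ContinuousLinearMap.proj ⟨p, by simp⟩,
    fun ω => ?_⟩
  simp [reflect]

theorem integral_reflect {X : I → Ω → ℝ} (hX : ∀ p, Integrable (X p) P)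
    (hmean : ∀ p, ∫ ω, X p ω ∂P = 0) (a p : I) :
    ∫ ω, reflect a (fun q => X q ω) p ∂P = 0 := by
  unfold reflect
  rw [integral_sub ((hX _).const_mul _) (hX _), integral_const_mul, hmean, hmean, mul_zero,
    sub_zero]

theorem covariance_reflect [IsFiniteMeasure P] {X : I → Ω → ℝ} (hX : ∀ p, MemLp (X p) 2 P)
    {f : I → ℝ} (hcov : ∀ p q, cov[X p, X q; P] = f (p ⊔ q)) (a p q : I) :
    cov[fun ω => reflect a (fun r => X r ω) p, fun ω => reflect a (fun r => X r ω) q; P] =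
      f (p ⊔ q) := by
  have hX2 : ∀ r, MemLp (fun ω => 2 * X r ω) 2 P := fun r => (hX r).const_mul 2
  unfold reflect
  rw [covariance_fun_sub_fun_sub (hX2 _) (hX _) (hX2 _) (hX _)]
  simp only [covariance_const_mul_left, covariance_const_mul_right, hcov]
  rw [← sup_sup_distrib_right, sup_comm q a, ← sup_assoc, sup_right_comm]
  ring

theorem measurePreserving_reflect [Countable I] {X : I → Ω → ℝ} (hX : IsGaussianProcess X P)
    (hmean : ∀ p, ∫ ω, X p ω ∂P = 0) {f : I → ℝ} (hcov : ∀ p q, cov[X p, X q; P] = f (p ⊔ q))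
    (a : I) :
    MeasurePreserving (reflect a) (P.map fun ω p => X p ω) (P.map fun ω p => X p ω) where
  measurable := measurable_reflect a
  map_eq := by
    have := hX.isProbabilityMeasure
    rw [AEMeasurable.map_map_of_aemeasurable (measurable_reflect a).aemeasurable
      (aemeasurable_path hX)]
    refine map_path_eq_of_covariance_eq (isGaussianProcess_reflect hX a) hX (fun p => ?_)
      fun p q => ?_
    · exact (integral_reflect (fun p => (hX.hasGaussianLaw_eval p).integrable) hmean a p).trans
        (hmean p).symm
    · exact (covariance_reflect (fun p => (hX.hasGaussianLaw_eval p).memLp_two) hcov a p q).trans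
        (hcov p q).symm

end Reflection

section LevyInequality

/-- The paths that exceed `u` in absolute value at some point of `A`. -/
def exceedsOn {I : Type*} (A : Set I) (u : ℝ) : Set (I → ℝ) := {x | ∃ p ∈ A, u < |x p|}

theorem measurableSet_exceedsOn {I : Type*} {A : Set I} (hA : A.Countable) (u : ℝ) :
    MeasurableSet (exceedsOn A u) := by
  simp only [exceedsOn, ← exists_prop, Set.ofPred_exists]
  exact .biUnion hA fun p _ => measurableSet_lt measurable_const (by fun_prop)

theorem measure_biUnion_le_mul {α ι : Type*} [MeasurableSpace α] {μ : Measure α} {s : Finset ι}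
    {A : ι → Set α} {F : Set α} (hA : ∀ i ∈ s, MeasurableSet (A i)) (hF : MeasurableSet F)
    (hdisj : (s : Set ι).PairwiseDisjoint A) {c : ℝ≥0∞}
    (h : ∀ i ∈ s, μ (A i) ≤ c * μ (A i ∩ F)) : μ (⋃ i ∈ s, A i) ≤ c * μ F :=
  calc μ (⋃ i ∈ s, A i) ≤ ∑ i ∈ s, μ (A i) := measure_biUnion_finset_le _ _
    _ ≤ ∑ i ∈ s, c * μ (A i ∩ F) := Finset.sum_le_sum h
    _ = c * μ (⋃ i ∈ s, A i ∩ F) := by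
      rw [← Finset.mul_sum, measure_biUnion_finset (hdisj.mono fun i => Set.inter_subset_left)
        fun i hi => (hA i hi).inter hF]
    _ ≤ c * μ F := by
      gcongr
      exact Set.iUnion₂_subset fun i _ => Set.inter_subset_right

variable {ι T : Type*} [LinearOrder T]

/-- The paths that exceed `u` in absolute value at a point of `B` with `k`-th coordinate `v`, and at
no point of `B` with a larger `k`-th coordinate: if the `k`-th coordinate runs through its values
downwards, then `v` is the first one at which the level `u` is passed. -/
def firstPassage (B : Finset (ι → T)) (k : ι) (u : ℝ) (v : T) : Set ((ι → T) → ℝ) :=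
  exceedsOn {p ∈ B | p k = v} u \ exceedsOn {p ∈ B | v < p k} u

variable {B : Finset (ι → T)} {k : ι} {u : ℝ}

theorem measurableSet_firstPassage (v : T) : MeasurableSet (firstPassage B k u v) :=
  (measurableSet_exceedsOn (B.finite_toSet.subset (Set.sep_subset _ _)).countable u).diff
    (measurableSet_exceedsOn (B.finite_toSet.subset (Set.sep_subset _ _)).countable u)

theorem pairwise_disjoint_firstPassage :
    Pairwise (Function.onFun Disjoint (firstPassage B k u)) := by
  have disjoint_of_lt : ∀ v w, v < w → Disjoint (firstPassage B k u v) (firstPassage B k u w) := by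
    refine fun v w hvw => Set.disjoint_left.2 fun x hv hw => ?_
    obtain ⟨p, ⟨hpB, rfl⟩, hp⟩ := hw.1
    exact hv.2 ⟨p, ⟨hpB, hvw⟩, hp⟩
  intro v w hvw
  exact hvw.lt_or_gt.elim (disjoint_of_lt v w) fun h => (disjoint_of_lt w v h).symm

theorem exceedsOn_subset_iUnion_firstPassage :
    exceedsOn B u ⊆ ⋃ v ∈ B.image (· k), firstPassage B k u v := by
  rintro x ⟨p, hp, hpu⟩
  obtain ⟨q, hq, hmax⟩ := (B.filter fun p => u < |x p|).exists_max_image (· k)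
    ⟨p, Finset.mem_filter.2 ⟨hp, hpu⟩⟩
  rw [Finset.mem_filter] at hq
  refine Set.mem_iUnion₂.2 ⟨q k, Finset.mem_image_of_mem _ hq.1, ⟨q, ⟨hq.1, rfl⟩, hq.2⟩, ?_⟩
  rintro ⟨r, ⟨hrB, hqr⟩, hru⟩
  exact (hmax r (Finset.mem_filter.2 ⟨hrB, hru⟩)).not_gt hqr

variable [OrderBot T] [DecidableEq ι]

theorem sup_update_bot (p : ι → T) (k : ι) (v : T) :
    p ⊔ Function.update ⊥ k v = Function.update p k (p k ⊔ v) := by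
  ext j
  by_cases hj : j = k <;> simp [hj]

theorem firstPassage_subset_union_preimage_reflect (v : T) :
    firstPassage B k u v ⊆
      (firstPassage B k u v ∩ exceedsOn ((fun p => Function.update p k ⊥) '' B) u) ∪
      reflect (Function.update ⊥ k v) ⁻¹'
        (firstPassage B k u v ∩ exceedsOn ((fun p => Function.update p k ⊥) '' B) u) := by
  have reflect_eq : ∀ (x : (ι → T) → ℝ) p, v ≤ p k → reflect (Function.update ⊥ k v) x p = x p :=
    fun x p hp => reflect_apply_of_le (update_le_iff.2 ⟨hp, fun _ _ => bot_le⟩) x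
  intro x hx
  obtain ⟨p, ⟨hpB, hpv⟩, hpu⟩ := hx.1
  -- At `update p k ⊥` the values of `x` and of its reflection have mean `x p`.
  by_cases hbot : u < |x (Function.update p k ⊥)|
  · exact Or.inl ⟨hx, _, ⟨p, hpB, rfl⟩, hbot⟩
  · refine Or.inr ⟨⟨⟨p, ⟨hpB, hpv⟩, ?_⟩, ?_⟩, _, ⟨p, hpB, rfl⟩, ?_⟩
    · rwa [reflect_eq x p hpv.ge]
    · rintro ⟨q, ⟨hqB, hvq⟩, hqu⟩
      exact hx.2 ⟨q, ⟨hqB, hvq⟩, by rwa [reflect_eq x q hvq.le] at hqu⟩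
    · have hvalue : reflect (Function.update ⊥ k v) x (Function.update p k ⊥) =
          2 * x p - x (Function.update p k ⊥) := by
        rw [reflect, sup_update_bot, Function.update_self, bot_sup_eq, Function.update_idem,
          ← hpv, Function.update_eq_self]
      have htriangle := abs_sub_abs_le_abs_sub (2 * x p) (x (Function.update p k ⊥))
      rw [abs_mul, abs_two] at htriangle
      rw [hvalue]
      linarith

theorem measure_exceedsOn_le_two_mul {μ : Measure ((ι → T) → ℝ)}
    (hμ : ∀ v, MeasurePreserving (reflect (Function.update ⊥ k v)) μ μ) (B : Finset (ι → T))
    (u : ℝ) :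
    μ (exceedsOn B u) ≤ 2 * μ (exceedsOn ((fun p => Function.update p k ⊥) '' B) u) := by
  have hF : MeasurableSet (exceedsOn ((fun p => Function.update p k ⊥) '' (B : Set (ι → T))) u) :=
    measurableSet_exceedsOn (B.finite_toSet.image _).countable u
  refine (measure_mono (exceedsOn_subset_iUnion_firstPassage (k := k))).trans
    (measure_biUnion_le_mul (fun v _ => measurableSet_firstPassage v) hF
      (pairwise_disjoint_firstPassage.set_pairwise _) fun v _ => ?_)
  refine (measure_mono (firstPassage_subset_union_preimage_reflect v)).trans
    ((measure_union_le _ _).trans_eq ?_)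
  rw [(hμ v).measure_preimage ((measurableSet_firstPassage v).inter hF).nullMeasurableSet, two_mul]

theorem measure_exceedsOn_le_two_pow_mul {μ : Measure ((ι → T) → ℝ)}
    (hμ : ∀ k v, MeasurePreserving (reflect (Function.update ⊥ k v)) μ μ) (B : Finset (ι → T))
    (u : ℝ) (K : Finset ι) :
    μ (exceedsOn B u) ≤ 2 ^ K.card * μ (exceedsOn ((fun p => K.piecewise ⊥ p) '' B) u) := by
  classical
  induction K using Finset.induction_on with
  | empty => simp
  | insert k K hk ih =>
    have himage : (fun p : ι → T => (insert k K).piecewise ⊥ p) '' B =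
        (fun p => Function.update p k ⊥) '' ((fun p => K.piecewise ⊥ p) '' B) := by
      rw [Set.image_image]
      simp only [Finset.piecewise_insert, Pi.bot_apply]
    rw [Finset.card_insert_of_notMem hk, pow_succ, mul_assoc, himage]
    refine ih.trans (mul_le_mul_right ?_ _)
    rw [← Finset.coe_image]
    exact measure_exceedsOn_le_two_mul (hμ k) _ u

theorem measure_exceedsOn_univ_le [Fintype ι] [Countable T] {μ : Measure ((ι → T) → ℝ)}
    (hμ : ∀ k v, MeasurePreserving (reflect (Function.update ⊥ k v)) μ μ) (u : ℝ) :
    μ (exceedsOn Set.univ u) ≤ 2 ^ Fintype.card ι * μ {x | u < |x ⊥|} := by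
  have hunion : exceedsOn (Set.univ : Set (ι → T)) u = ⋃ B : Finset (ι → T), exceedsOn B u :=
    Set.Subset.antisymm
      (fun x ⟨p, _, hp⟩ => Set.mem_iUnion.2 ⟨{p}, p, Finset.mem_coe.2 (by simp), hp⟩)
      (Set.iUnion_subset fun B x ⟨p, _, hp⟩ => ⟨p, Set.mem_univ p, hp⟩)
  have hmono : Monotone fun B : Finset (ι → T) => exceedsOn (B : Set (ι → T)) u :=
    fun B C hBC x ⟨p, hpB, hp⟩ => ⟨p, hBC hpB, hp⟩
  rw [hunion, hmono.directed_le.measure_iUnion]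
  refine iSup_le fun B => (measure_exceedsOn_le_two_pow_mul hμ B u Finset.univ).trans ?_
  rw [Finset.card_univ]
  refine mul_le_mul_right (measure_mono ?_) _
  rintro x ⟨_, ⟨p, -, rfl⟩, hp⟩
  simpa using hp

end LevyInequality

section Sheet

variable {Ω ι T : Type*} [MeasurableSpace Ω] {P : Measure Ω} [Fintype ι] [LinearOrder T]
  [OrderBot T] {X : (ι → T) → Ω → ℝ} {f : (ι → T) → ℝ} {u : ℝ}

theorem measure_exists_mem_lt_abs_le (hX : IsGaussianProcess X P) (hmean : ∀ p, ∫ ω, X p ω ∂P = 0)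
    (hcov : ∀ p q, cov[X p, X q; P] = f (p ⊔ q)) {D : Set T} (hD : D.Countable) (hbot : ⊥ ∈ D) :
    P {ω | ∃ p : ι → T, (∀ k, p k ∈ D) ∧ u < |X p ω|} ≤
      2 ^ Fintype.card ι * P {ω | u < |X ⊥ ω|} := by
  classical
  have := hD.to_subtype
  let _ : OrderBot D := Subtype.orderBot hbot
  let incl : (ι → D) → ι → T := fun p k => p k
  have hY : IsGaussianProcess (fun p => X (incl p)) P := hX.comp_right incl
  have hpath := aemeasurable_path hY
  have hle := measure_exceedsOn_univ_le (fun k v => measurePreserving_reflect hY (fun p => hmean _)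
    (f := fun p => f (incl p)) (fun p q => hcov _ _) (Function.update ⊥ k v)) u
  rw [Measure.map_apply_of_aemeasurable hpath (measurableSet_exceedsOn Set.countable_univ u),
    Measure.map_apply_of_aemeasurable hpath
      (measurableSet_lt measurable_const (by fun_prop))] at hle
  refine (measure_mono ?_).trans hle
  rintro ω ⟨p, hpD, hp⟩
  exact ⟨fun k => ⟨p k, hpD k⟩, Set.mem_univ _, hp⟩

theorem measure_exists_lt_abs_le [TopologicalSpace T] [TopologicalSpace.SeparableSpace T]
    (hX : IsGaussianProcess X P) (hmean : ∀ p, ∫ ω, X p ω ∂P = 0)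
    (hcov : ∀ p q, cov[X p, X q; P] = f (p ⊔ q)) (hcont : ∀ᵐ ω ∂P, Continuous fun p => X p ω) :
    P {ω | ∃ p, u < |X p ω|} ≤ 2 ^ Fintype.card ι * P {ω | u < |X ⊥ ω|} := by
  obtain ⟨D, hDc, hDd⟩ := TopologicalSpace.exists_countable_dense T
  have hdense : Dense (Set.univ.pi fun _ : ι => insert ⊥ D) :=
    dense_pi _ fun _ _ => hDd.mono (Set.subset_insert _ _)
  refine (measure_mono_ae ?_).trans
    (measure_exists_mem_lt_abs_le hX hmean hcov (hDc.insert ⊥) (Set.mem_insert _ _))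
  filter_upwards [hcont] with ω hω
  rintro ⟨p, hp⟩
  obtain ⟨q, hq, hqD⟩ := hdense.inter_open_nonempty {q | u < |X q ω|}
    (isOpen_lt continuous_const hω.abs) ⟨p, hp⟩
  exact ⟨q, fun k => hqD k (Set.mem_univ k), hq⟩

end Sheet

section Noise

variable {d : ℕ} {κ : Fin d}

/-- The noise term of `V`: the path `γ` normalised by the volume `∏_{k = κ}^d (g₁ + g₂)_k`. -/
noncomputable def normalizedNoise (κ : Fin d) (γ : Orthant d × Orthant d → ℝ)
    (g₁ g₂ : Orthant d) : ℝ :=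
  γ (g₁, g₂) / ∏ k ∈ upperCoords κ, ((g₁ k : ℝ) + g₂ k)

theorem normalizedNoise_swap (κ : Fin d) (γ : Orthant d × Orthant d → ℝ) (g₁ g₂ : Orthant d) :
    normalizedNoise κ (fun p => γ p.swap) g₁ g₂ = normalizedNoise κ γ g₂ g₁ := by
  simp only [normalizedNoise, Prod.swap_prod_mk, add_comm]

variable {Ω : Type*} [MeasurableSpace Ω] {P : Measure Ω} {G : Orthant d × Orthant d → Ω → ℝ}

theorem IsNoise.swap (hG : IsNoise P κ G) : IsNoise P κ fun p => G p.swap where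
  gaussian := hG.gaussian.comp_right Prod.swap
  centered p := hG.centered p.swap
  covariance_eq p q := by
    rw [hG.covariance_eq]
    simp only [Prod.fst_swap, Prod.snd_swap, add_comm]
  continuous_paths := hG.continuous_paths.mono fun _ hω => hω.comp continuous_swap

theorem IsNoise.isGaussianProcess_normalizedNoise (hG : IsNoise P κ G) (b : Orthant d) :
    IsGaussianProcess (fun g ω => normalizedNoise κ (fun p => G p ω) g b) P := by
  simp only [normalizedNoise, div_eq_inv_mul]
  exact (hG.gaussian.comp_right fun g => (g, b)).smul
    fun g => (∏ k ∈ upperCoords κ, ((g k : ℝ) + b k))⁻¹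

theorem IsNoise.integral_normalizedNoise (hG : IsNoise P κ G) (g₁ g₂ : Orthant d) :
    ∫ ω, normalizedNoise κ (fun p => G p ω) g₁ g₂ ∂P = 0 := by
  simp only [normalizedNoise, integral_div, hG.centered, zero_div]

theorem min_add_div_mul_eq_inv_max_add {x y b : ℝ} (hx : 0 < x + b) (hy : 0 < y + b) :
    (min x y + b) / ((x + b) * (y + b)) = (max x y + b)⁻¹ := by
  rw [← min_add_add_right, ← max_add_add_right, ← min_mul_max (x + b),
    div_mul_cancel_left₀ (lt_min hx hy).ne']

variable {b : Orthant d}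

theorem coe_add_coe_pos (hb : ∀ k, 0 < b k) (g : Orthant d) (k : Fin d) : (0 : ℝ) < g k + b k :=
  add_pos_of_nonneg_of_pos (g k).2 (hb k)

theorem IsNoise.covariance_normalizedNoise (hG : IsNoise P κ G) (hb : ∀ k, 0 < b k)
    (g g' : Orthant d) :
    cov[fun ω => normalizedNoise κ (fun p => G p ω) g b,
        fun ω => normalizedNoise κ (fun p => G p ω) g' b; P] =
      ∏ k ∈ upperCoords κ, (((g ⊔ g') k : ℝ) + b k)⁻¹ := by
  unfold normalizedNoise
  rw [covariance_fun_div_left, covariance_fun_div_right, hG.covariance_eq, div_div, mul_comm,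
    ← Finset.prod_mul_distrib, ← Finset.prod_div_distrib]
  refine Finset.prod_congr rfl fun k _ => ?_
  rw [min_self, NNReal.coe_add, NNReal.coe_min, Pi.sup_apply, NNReal.coe_max]
  exact min_add_div_mul_eq_inv_max_add (coe_add_coe_pos hb g k) (coe_add_coe_pos hb g' k)

theorem IsNoise.ae_continuous_normalizedNoise (hG : IsNoise P κ G) (hb : ∀ k, 0 < b k) :
    ∀ᵐ ω ∂P, Continuous fun g => normalizedNoise κ (fun p => G p ω) g b := by
  filter_upwards [hG.continuous_paths] with ω hω
  exact (hω.comp (by fun_prop)).div (by fun_prop) fun g =>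
    (Finset.prod_pos fun k _ => coe_add_coe_pos hb g k).ne'

theorem IsNoise.measure_exists_lt_abs_normalizedNoise_le (hG : IsNoise P κ G) (hb : ∀ k, 0 < b k)
    {u : ℝ} (hu : 0 ≤ u) :
    P {ω | ∃ g, u < |normalizedNoise κ (fun p => G p ω) g b|} ≤ 2 ^ (d + 1) * ENNReal.ofReal
      (Real.exp (-u ^ 2 / (2 * ∏ k ∈ upperCoords κ, (b k : ℝ)⁻¹))) := by
  have hgauss := hG.isGaussianProcess_normalizedNoise b
  have hvar : Var[fun ω => normalizedNoise κ (fun p => G p ω) ⊥ b; P] =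
      ∏ k ∈ upperCoords κ, (b k : ℝ)⁻¹ := by
    rw [← covariance_self (hgauss.aemeasurable _), hG.covariance_normalizedNoise hb]
    simp only [sup_idem, Pi.bot_apply, NNReal.bot_eq_zero, NNReal.coe_zero, zero_add]
  have htail := measure_lt_abs_le_two_mul_exp (hasSubgaussianMGF_of_hasGaussianLaw
    (hgauss.hasGaussianLaw_eval ⊥) (hG.integral_normalizedNoise ⊥ b)) hu
  rw [Real.coe_toNNReal _ (variance_nonneg _ _), hvar] at htail
  refine (measure_exists_lt_abs_le hgauss (fun g => hG.integral_normalizedNoise g b)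
    (f := fun g : Orthant d => ∏ k ∈ upperCoords κ, ((g k : ℝ) + b k)⁻¹)
    (hG.covariance_normalizedNoise hb) (hG.ae_continuous_normalizedNoise hb)).trans ?_
  rw [Fintype.card_fin, pow_succ, mul_assoc]
  exact mul_le_mul_right htail _

/-- The event that the normalised noise stays in `[-u, u]` along the two sections that are frozen
at a reference point `b₁` of the first and `b₂` of the second argument. -/
structure SectionsBounded (κ : Fin d) (γ : Orthant d × Orthant d → ℝ) (b₁ b₂ : Orthant d)
    (u : ℝ) : Prop where
  abs_fst_le : ∀ g, |normalizedNoise κ γ g b₂| ≤ u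
  abs_snd_le : ∀ g, |normalizedNoise κ γ b₁ g| ≤ u

theorem IsNoise.measure_not_sectionsBounded_le (hG : IsNoise P κ G) {b₁ b₂ : Orthant d}
    (hb₁ : ∀ k, 0 < b₁ k) (hb₂ : ∀ k, 0 < b₂ k) {σ : ℝ}
    (hσ₁ : ∏ k ∈ upperCoords κ, (b₁ k : ℝ)⁻¹ ≤ σ) (hσ₂ : ∏ k ∈ upperCoords κ, (b₂ k : ℝ)⁻¹ ≤ σ)
    {u : ℝ} (hu : 0 ≤ u) :
    P {ω | ¬ SectionsBounded κ (fun p => G p ω) b₁ b₂ u} ≤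
      ENNReal.ofReal (2 ^ (d + 2) * Real.exp (-u ^ 2 / (2 * σ))) := by
  have hcover : {ω | ¬ SectionsBounded κ (fun p => G p ω) b₁ b₂ u} ⊆
      {ω | ∃ g, u < |normalizedNoise κ (fun p => G p ω) g b₂|} ∪
      {ω | ∃ g, u < |normalizedNoise κ (fun p => G p.swap ω) g b₁|} := by
    intro ω hω
    by_contra hnot
    simp only [Set.mem_union, Set.mem_ofPred_eq, not_or, not_exists, not_lt,
      normalizedNoise_swap κ fun p => G p ω] at hnot
    exact hω ⟨hnot.1, hnot.2⟩
  have hexp : ∀ b : Orthant d, (∀ k, 0 < b k) → ∏ k ∈ upperCoords κ, (b k : ℝ)⁻¹ ≤ σ →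
      Real.exp (-u ^ 2 / (2 * ∏ k ∈ upperCoords κ, (b k : ℝ)⁻¹)) ≤
        Real.exp (-u ^ 2 / (2 * σ)) := fun b hb hσ => by
    have hpos : 0 < ∏ k ∈ upperCoords κ, (b k : ℝ)⁻¹ :=
      Finset.prod_pos fun k _ => inv_pos.2 (hb k)
    rw [neg_div, neg_div]
    gcongr
  calc P {ω | ¬ SectionsBounded κ (fun p => G p ω) b₁ b₂ u}
    _ ≤ 2 ^ (d + 1) * ENNReal.ofReal (Real.exp (-u ^ 2 / (2 * σ))) +
        2 ^ (d + 1) * ENNReal.ofReal (Real.exp (-u ^ 2 / (2 * σ))) :=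
      (measure_mono hcover).trans <| (measure_union_le _ _).trans <| add_le_add
        ((hG.measure_exists_lt_abs_normalizedNoise_le hb₂ hu).trans <|
          mul_le_mul_right (ENNReal.ofReal_le_ofReal (hexp b₂ hb₂ hσ₂)) _)
        ((hG.swap.measure_exists_lt_abs_normalizedNoise_le hb₁ hu).trans <|
          mul_le_mul_right (ENNReal.ofReal_le_ofReal (hexp b₁ hb₁ hσ₁)) _)
    _ = ENNReal.ofReal (2 ^ (d + 2) * Real.exp (-u ^ 2 / (2 * σ))) := by
      rw [ENNReal.ofReal_mul (by positivity), ENNReal.ofReal_pow zero_le_two, ENNReal.ofReal_ofNat]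
      ring

end Noise

section Bias

theorem Smoothness.one_le_exp {d : ℕ} {α : Smoothness d} {k : Fin d} (hk : (k : ℕ) < α.s) :
    1 ≤ α.exp k := by
  have hone := α.one_le k
  rw [← ENat.natCast_toNat ((α.lt_top_iff k).2 hk).ne] at hone
  exact_mod_cast hone

theorem neg_one_le_pow_sub_pow_div {b g : ℝ} (hb : 0 < b) (hb1 : b ≤ 1) (hg : 0 ≤ g) (n : ℕ) :
    -1 ≤ (g ^ (n + 1) - b ^ (n + 1)) / (g + b) := by
  have hpow : b ^ (n + 1) ≤ b := pow_le_of_le_one hb.le hb1 n.succ_ne_zero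
  have hgpow : 0 ≤ g ^ (n + 1) := by positivity
  rw [le_div_iff₀ (by positivity)]
  linarith

theorem le_pow_sub_pow_div_add_two {b g : ℝ} (hb : 0 < b) (hb1 : b ≤ 1) (hg : 0 ≤ g) {n : ℕ}
    (hn : 1 ≤ n) : g ≤ (g ^ (n + 1) - b ^ (n + 1)) / (g + b) + 2 := by
  rcases le_total g 1 with hg1 | hg1
  · linarith [neg_one_le_pow_sub_pow_div hb hb1 hg n]
  · have hpow : b ^ (n + 1) ≤ 1 := pow_le_one₀ hb.le hb1
    have hsq : g ^ 2 ≤ g ^ (n + 1) := pow_le_pow_right₀ hg1 (by lia)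
    have hdiv : g - 1 ≤ (g ^ (n + 1) - b ^ (n + 1)) / (g + b) := by
      rw [le_div_iff₀ (by positivity)]
      nlinarith
    linarith

variable {d : ℕ} {α : Smoothness d} {κ : Fin d} {b g : Orthant d}

/-- The bias term `∑_{k = κ}^s (g_k ^ (α_k + 1) - b_k ^ (α_k + 1)) / (g_k + b_k)` of `V`. -/
noncomputable def bias (α : Smoothness d) (κ : Fin d) (b g : Orthant d) : ℝ :=
  ∑ k ∈ activeCoords α κ,
    ((g k : ℝ) ^ (α.exp k + 1) - (b k : ℝ) ^ (α.exp k + 1)) / ((g k : ℝ) + b k)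

theorem V_eq_normalizedNoise_add_bias (γ : Orthant d × Orthant d → ℝ) (g₁ g₂ : Orthant d) :
    V α κ γ g₁ g₂ = normalizedNoise κ γ g₁ g₂ + bias α κ g₁ g₂ := rfl

theorem bias_swap (b g : Orthant d) : bias α κ g b = -bias α κ b g := by
  simp only [bias, ← Finset.sum_neg_distrib, ← neg_div, neg_sub, add_comm]

theorem card_activeCoords_le (α : Smoothness d) (κ : Fin d) : (activeCoords α κ).card ≤ d :=
  (Finset.card_le_univ _).trans_eq (Fintype.card_fin d)

theorem neg_natCast_le_bias (hb : ∀ k, 0 < b k) (hb1 : ∀ k, b k ≤ 1) (g : Orthant d) :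
    -(d : ℝ) ≤ bias α κ b g := by
  have hsum : (activeCoords α κ).card • (-1 : ℝ) ≤ bias α κ b g :=
    Finset.card_nsmul_le_sum _ _ _ fun k _ =>
      neg_one_le_pow_sub_pow_div (hb k) (hb1 k) (g k).2 _
  have hcard : ((activeCoords α κ).card : ℝ) ≤ d := by exact_mod_cast card_activeCoords_le α κ
  rw [nsmul_eq_mul] at hsum
  linarith

theorem coe_le_bias_add (hb : ∀ k, 0 < b k) (hb1 : ∀ k, b k ≤ 1) {k : Fin d}
    (hk : k ∈ activeCoords α κ) : (g k : ℝ) ≤ bias α κ b g + d + 2 := by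
  have hterm := le_pow_sub_pow_div_add_two (hb k) (hb1 k) (g k).2
    (Smoothness.one_le_exp (Finset.mem_filter.1 hk).2.2)
  have hrest : ((activeCoords α κ).erase k).card • (-1 : ℝ) ≤
      ∑ j ∈ (activeCoords α κ).erase k,
        ((g j : ℝ) ^ (α.exp j + 1) - (b j : ℝ) ^ (α.exp j + 1)) / ((g j : ℝ) + b j) :=
    Finset.card_nsmul_le_sum _ _ _ fun j _ =>
      neg_one_le_pow_sub_pow_div (hb j) (hb1 j) (g j).2 _
  have hcard : (((activeCoords α κ).erase k).card : ℝ) ≤ d := by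
    exact_mod_cast Finset.card_erase_le.trans (card_activeCoords_le α κ)
  rw [nsmul_eq_mul] at hrest
  rw [bias, ← Finset.add_sum_erase _ _ hk]
  simp only [NNReal.val_eq_coe] at hterm
  linarith

end Bias

section OptimalPair

variable {d : ℕ} {α : Smoothness d} {κ : Fin d} {γ : Orthant d × Orthant d → ℝ}
  {b₁ b₂ g₁ g₂ : Orthant d} {u : ℝ}

theorem V_le_of_sectionsBounded (hsec : SectionsBounded κ γ b₁ b₂ u) (hb₂ : ∀ k, 0 < b₂ k)
    (hb₂1 : ∀ k, b₂ k ≤ 1) (g : Orthant d) : V α κ γ g b₂ ≤ u + d := by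
  rw [V_eq_normalizedNoise_add_bias, bias_swap]
  linarith [(abs_le.1 (hsec.abs_fst_le g)).2, neg_natCast_le_bias (α := α) (κ := κ) hb₂ hb₂1 g]

theorem neg_le_V_of_sectionsBounded (hsec : SectionsBounded κ γ b₁ b₂ u) (hb₁ : ∀ k, 0 < b₁ k)
    (hb₁1 : ∀ k, b₁ k ≤ 1) (g : Orthant d) : -(u + d) ≤ V α κ γ b₁ g := by
  rw [V_eq_normalizedNoise_add_bias]
  linarith [(abs_le.1 (hsec.abs_snd_le g)).1, neg_natCast_le_bias (α := α) (κ := κ) hb₁ hb₁1 g]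

theorem coe_le_of_neg_le_V (hsec : SectionsBounded κ γ b₁ b₂ u) (hb₂ : ∀ k, 0 < b₂ k)
    (hb₂1 : ∀ k, b₂ k ≤ 1) (h : -(u + d) ≤ V α κ γ g₁ b₂) {k : Fin d}
    (hk : k ∈ activeCoords α κ) : (g₁ k : ℝ) ≤ 2 * (u + d + 1) := by
  rw [V_eq_normalizedNoise_add_bias, bias_swap] at h
  linarith [(abs_le.1 (hsec.abs_fst_le g₁)).2, coe_le_bias_add (g := g₁) hb₂ hb₂1 hk]

theorem coe_le_of_V_le (hsec : SectionsBounded κ γ b₁ b₂ u) (hb₁ : ∀ k, 0 < b₁ k)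
    (hb₁1 : ∀ k, b₁ k ≤ 1) (h : V α κ γ b₁ g₂ ≤ u + d) {k : Fin d}
    (hk : k ∈ activeCoords α κ) : (g₂ k : ℝ) ≤ 2 * (u + d + 1) := by
  rw [V_eq_normalizedNoise_add_bias] at h
  linarith [(abs_le.1 (hsec.abs_snd_le g₂)).1, coe_le_bias_add (g := g₂) hb₁ hb₁1 hk]

theorem S_le_rpow {R : ℝ} (hR : 1 ≤ R) (h : ∀ k ∈ activeCoords α κ, (g₂ k : ℝ) + g₁ k ≤ R) :
    S α κ g₁ g₂ ≤ R ^ ((d : ℝ) / 2) := by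
  have hprod : ∏ k ∈ activeCoords α κ, ((g₂ k : ℝ) + g₁ k) ≤ R ^ d :=
    calc ∏ k ∈ activeCoords α κ, ((g₂ k : ℝ) + g₁ k)
      _ ≤ ∏ _k ∈ activeCoords α κ, R := Finset.prod_le_prod (fun k _ => by positivity) h
      _ = R ^ (activeCoords α κ).card := Finset.prod_const _
      _ ≤ R ^ d := pow_le_pow_right₀ hR (card_activeCoords_le α κ)
  calc S α κ g₁ g₂ ≤ √(R ^ d) := Real.sqrt_le_sqrt hprod
    _ = R ^ ((d : ℝ) / 2) := by
      rw [Real.sqrt_eq_rpow, ← Real.rpow_natCast_mul (by linarith), mul_one_div]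

variable {x₀ : Fin d → ℝ}

theorem VSupInf_le_VInfSup (x₀ : Fin d → ℝ) (α : Smoothness d) (κ : Fin d)
    (γ : Orthant d × Orthant d → ℝ) : VSupInf x₀ α κ γ ≤ VInfSup x₀ α κ γ :=
  iSup₂_le fun g₁ h₁ => le_iInf₂ fun g₂ h₂ =>
    iInf₂_le_of_le g₂ h₂ (le_iSup₂ (f := fun g (_ : g ∈ G1 x₀ α) => (V α κ γ g g₂ : EReal)) g₁ h₁)

theorem VInfSup_le_of_sectionsBounded (hsec : SectionsBounded κ γ b₁ b₂ u) (hb₂ : b₂ ∈ G2 x₀ α)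
    (hb₂1 : ∀ k, b₂ k ≤ 1) : VInfSup x₀ α κ γ ≤ ((u + d : ℝ) : EReal) :=
  iInf₂_le_of_le b₂ hb₂ <| iSup₂_le fun g _ =>
    EReal.coe_le_coe_iff.2 (V_le_of_sectionsBounded hsec hb₂.1 hb₂1 g)

theorem neg_le_VSupInf_of_sectionsBounded (hsec : SectionsBounded κ γ b₁ b₂ u)
    (hb₁ : b₁ ∈ G1 x₀ α) (hb₁1 : ∀ k, b₁ k ≤ 1) :
    ((-(u + d) : ℝ) : EReal) ≤ VSupInf x₀ α κ γ :=
  le_iSup₂_of_le b₁ hb₁ <| le_iInf₂ fun g _ =>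
    EReal.coe_le_coe_iff.2 (neg_le_V_of_sectionsBounded hsec hb₁.1 hb₁1 g)

theorem abs_mul_half_mul_add_le {a b : EReal} {c R : ℝ} (hc : 0 ≤ c) (ha : ((-R : ℝ) : EReal) ≤ a)
    (hab : a ≤ b) (hb : b ≤ R) :
    (((c * (1 / 2) : ℝ) : EReal) * (a + b)).abs ≤ ENNReal.ofReal (c * R) := by
  lift a to ℝ using ⟨((hab.trans hb).trans_lt (EReal.coe_lt_top R)).ne,
    ((EReal.bot_lt_coe _).trans_le ha).ne'⟩
  lift b to ℝ using ⟨(hb.trans_lt (EReal.coe_lt_top R)).ne,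
    ((EReal.bot_lt_coe a).trans_le hab).ne'⟩
  rw [EReal.coe_le_coe_iff] at ha hab hb
  rw [← EReal.coe_add, ← EReal.coe_mul, EReal.abs_def, mul_assoc, abs_mul, abs_of_nonneg hc]
  have hmean : |1 / 2 * (a + b)| ≤ R := abs_le.2 ⟨by linarith, by linarith⟩
  gcongr

theorem IsOptimalPair.fst_add_snd_le (hopt : IsOptimalPair x₀ α κ γ g₁ g₂)
    (hsec : SectionsBounded κ γ b₁ b₂ u) (hb₁ : b₁ ∈ G1 x₀ α) (hb₁1 : ∀ k, b₁ k ≤ 1)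
    (hb₂ : b₂ ∈ G2 x₀ α) (hb₂1 : ∀ k, b₂ k ≤ 1) {k : Fin d} (hk : k ∈ activeCoords α κ) :
    (g₂ k : ℝ) + g₁ k ≤ 4 * (u + d + 1) := by
  have hV₁ : ((-(u + d) : ℝ) : EReal) ≤ V α κ γ g₁ b₂ :=
    (neg_le_VSupInf_of_sectionsBounded hsec hb₁ hb₁1).trans
      (hopt.attains₁.ge.trans (iInf₂_le b₂ hb₂))
  have hV₂ : (V α κ γ b₁ g₂ : EReal) ≤ ((u + d : ℝ) : EReal) :=
    ((le_iSup₂ (f := fun g (_ : g ∈ G1 x₀ α) => (V α κ γ g g₂ : EReal)) b₁ hb₁).trans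
      hopt.attains₂.le).trans (VInfSup_le_of_sectionsBounded hsec hb₂ hb₂1)
  linarith [coe_le_of_neg_le_V hsec hb₂.1 hb₂1 (EReal.coe_le_coe_iff.1 hV₁) hk,
    coe_le_of_V_le hsec hb₁.1 hb₁1 (EReal.coe_le_coe_iff.1 hV₂) hk]

theorem IsOptimalPair.abs_limitValue_le (hopt : IsOptimalPair x₀ α κ γ g₁ g₂)
    (hsec : SectionsBounded κ γ b₁ b₂ u) (hb₁ : b₁ ∈ G1 x₀ α) (hb₁1 : ∀ k, b₁ k ≤ 1)
    (hb₂ : b₂ ∈ G2 x₀ α) (hb₂1 : ∀ k, b₂ k ≤ 1) :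
    (limitValue x₀ α κ γ g₁ g₂).abs ≤
      ENNReal.ofReal ((4 * (u + d + 1)) ^ (((d : ℝ) + 2) / 2)) := by
  have hu : 0 ≤ u := (abs_nonneg _).trans (hsec.abs_fst_le g₁)
  refine (abs_mul_half_mul_add_le (Real.sqrt_nonneg _)
    (neg_le_VSupInf_of_sectionsBounded hsec hb₁ hb₁1) (VSupInf_le_VInfSup x₀ α κ γ)
    (VInfSup_le_of_sectionsBounded hsec hb₂ hb₂1)).trans (ENNReal.ofReal_le_ofReal ?_)
  calc S α κ g₁ g₂ * (u + d)
    _ ≤ (4 * (u + d + 1)) ^ ((d : ℝ) / 2) * (4 * (u + d + 1)) := by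
      gcongr
      · exact S_le_rpow (by linarith) fun k hk => hopt.fst_add_snd_le hsec hb₁ hb₁1 hb₂ hb₂1 hk
      · linarith
    _ = (4 * (u + d + 1)) ^ (((d : ℝ) + 2) / 2) := by
      rw [← Real.rpow_add_one (by linarith)]
      ring_nf

end OptimalPair

section TailBounds

theorem neg_sq_div_le_of_shift {w c m σ : ℝ} (hc : 0 < c) (hσ : 0 < σ) :
    -(w / c - m) ^ 2 / (2 * σ) ≤ m ^ 2 / (2 * σ) - w ^ 2 / (4 * c ^ 2 * σ) := by
  rw [← sub_nonneg]
  have hidentity : m ^ 2 / (2 * σ) - w ^ 2 / (4 * c ^ 2 * σ) - -(w / c - m) ^ 2 / (2 * σ) =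
      (w / c - 2 * m) ^ 2 / (4 * σ) := by
    field_simp
    ring
  rw [hidentity]
  positivity

theorem exists_stretchedExponential_tail_bound {K σ m r c : ℝ} (hK : 1 ≤ K) (hσ : 0 < σ)
    (hr : 0 < r) (hc : 0 < c) :
    ∃ L : ℝ, 0 < L ∧ ∀ p : ℝ → ℝ≥0∞, (∀ t, p t ≤ 1) →
      (∀ u, 0 ≤ u → p ((c * (u + m)) ^ r) ≤
        ENNReal.ofReal (K * Real.exp (-u ^ 2 / (2 * σ)))) →
      ∀ t, 0 ≤ t → p t ≤ ENNReal.ofReal (L * Real.exp (-t ^ (2 / r) / L)) := by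
  set L : ℝ := max (K * Real.exp (m ^ 2 / (2 * σ))) (4 * c ^ 2 * σ)
  have hL : 0 < L := lt_max_of_lt_right (by positivity)
  refine ⟨L, hL, fun p hp htail t ht => ?_⟩
  set w : ℝ := t ^ r⁻¹
  have hwt : w ^ r = t := Real.rpow_inv_rpow ht hr.ne'
  have hwsq : t ^ (2 / r) = w ^ 2 := by
    rw [← Real.rpow_mul_natCast ht, Nat.cast_ofNat, inv_mul_eq_div]
  have hbound : K * Real.exp (m ^ 2 / (2 * σ) - w ^ 2 / (4 * c ^ 2 * σ)) ≤
      L * Real.exp (-w ^ 2 / L) := by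
    rw [sub_eq_add_neg, Real.exp_add, ← mul_assoc, neg_div]
    gcongr
    · exact le_max_left _ _
    · exact le_max_right _ _
  rw [hwsq]
  rcases le_total (c * m) w with hmw | hmw
  · have hu : 0 ≤ w / c - m := sub_nonneg.2 ((le_div_iff₀' hc).2 hmw)
    have hlevel : (c * (w / c - m + m)) ^ r = t := by
      rw [sub_add_cancel, mul_div_cancel₀ _ hc.ne', hwt]
    refine (hlevel ▸ htail _ hu).trans (ENNReal.ofReal_le_ofReal (le_trans ?_ hbound))
    gcongr
    exact neg_sq_div_le_of_shift hc hσ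
  · refine (hp t).trans (ENNReal.one_le_ofReal.2 (le_trans ?_ hbound))
    refine one_le_mul_of_one_le_of_one_le hK (Real.one_le_exp (sub_nonneg.2 ?_))
    calc w ^ 2 / (4 * c ^ 2 * σ) ≤ (c * m) ^ 2 / (4 * c ^ 2 * σ) := by gcongr
      _ = m ^ 2 / (4 * σ) := by field_simp
      _ ≤ m ^ 2 / (2 * σ) := by gcongr; norm_num

theorem exists_forall_exp_neg_le {L a δ₀ : ℝ} (hL : 0 < L) (ha : 0 < a)
    (hδ₀ : δ₀ ∈ Set.Ioo (0 : ℝ) 1) :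
    ∃ C : ℝ, 0 < C ∧ ∀ δ, 0 < δ → δ ≤ δ₀ →
      L * Real.exp (-(C * Real.log (1 / δ) ^ a⁻¹) ^ a / L) ≤ δ := by
  have hlog₀ : 0 < Real.log (1 / δ₀) := Real.log_pos ((one_lt_div hδ₀.1).2 hδ₀.2)
  set B : ℝ := L * (1 + |Real.log L| / Real.log (1 / δ₀)) with hB
  have hBpos : 0 < B := by positivity
  refine ⟨B ^ a⁻¹, Real.rpow_pos_of_pos hBpos _, fun δ hδ hδδ₀ => ?_⟩
  have hlog : Real.log (1 / δ₀) ≤ Real.log (1 / δ) :=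
    Real.log_le_log (one_div_pos.2 hδ₀.1) (one_div_le_one_div_of_le hδ hδδ₀)
  have hlogL : Real.log L ≤ |Real.log L| / Real.log (1 / δ₀) * Real.log (1 / δ) :=
    calc Real.log L ≤ |Real.log L| := le_abs_self _
      _ = |Real.log L| / Real.log (1 / δ₀) * Real.log (1 / δ₀) := (div_mul_cancel₀ _ hlog₀.ne').symm
      _ ≤ |Real.log L| / Real.log (1 / δ₀) * Real.log (1 / δ) := by gcongr
  rw [← Real.mul_rpow hBpos.le (hlog₀.le.trans hlog),
    Real.rpow_inv_rpow (mul_nonneg hBpos.le (hlog₀.le.trans hlog)) ha.ne']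
  calc L * Real.exp (-(B * Real.log (1 / δ)) / L)
    _ = Real.exp (Real.log L - B * Real.log (1 / δ) / L) := by
      rw [Real.exp_sub, Real.exp_log hL, neg_div, Real.exp_neg, ← div_eq_mul_inv]
    _ ≤ Real.exp (-Real.log (1 / δ)) := by
      rw [hB, mul_assoc, mul_div_cancel_left₀ _ hL.ne']
      gcongr
      linarith
    _ = δ := by rw [one_div, Real.log_inv, neg_neg, Real.exp_log hδ]

end TailBounds

section Exceedance

variable {d : ℕ} {x : Fin d → ℝ}

/-- The corner of the box `∏ (0, x_k]`, as a point of the orthant. The choices `x = x₀` and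
`x = 1 - x₀` give points of `𝒢₁` and `𝒢₂` that do not depend on the smoothness. -/
noncomputable def boxCorner (x : Fin d → ℝ) : Orthant d := fun k => (x k).toNNReal

theorem coe_boxCorner (hx : ∀ k, 0 < x k) (k : Fin d) : (boxCorner x k : ℝ) = x k :=
  Real.coe_toNNReal _ (hx k).le

theorem boxCorner_mem_G1 (hx : ∀ k, 0 < x k) (α : Smoothness d) : boxCorner x ∈ G1 x α :=
  ⟨fun k => Real.toNNReal_pos.2 (hx k), fun k _ => (coe_boxCorner hx k).le⟩

theorem boxCorner_le_one (hx : ∀ k, x k < 1) (k : Fin d) : boxCorner x k ≤ 1 :=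
  Real.toNNReal_le_one.2 (hx k).le

theorem prod_inv_boxCorner_le (hx : ∀ k, x k ∈ Set.Ioo (0 : ℝ) 1) (s : Finset (Fin d)) :
    ∏ k ∈ s, (boxCorner x k : ℝ)⁻¹ ≤ ∏ k, (x k * (1 - x k))⁻¹ := by
  have hone : ∀ k, 1 ≤ (x k)⁻¹ := fun k => (one_le_inv₀ (hx k).1).2 (hx k).2.le
  simp only [coe_boxCorner fun k => (hx k).1]
  calc ∏ k ∈ s, (x k)⁻¹ ≤ ∏ k, (x k)⁻¹ :=
      Finset.prod_le_prod_of_subset_of_one_le s.subset_univ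
        (fun k _ => zero_le_one.trans (hone k)) fun k _ _ => hone k
    _ ≤ ∏ k, (x k * (1 - x k))⁻¹ := by
      refine Finset.prod_le_prod (fun k _ => zero_le_one.trans (hone k)) fun k _ => ?_
      obtain ⟨h0, h1⟩ := hx k
      exact inv_anti₀ (mul_pos h0 (sub_pos.2 h1)) (mul_le_of_le_one_right h0.le (by linarith))

theorem IsNoise.measure_exceedance_le {Ω : Type*} [MeasurableSpace Ω] {P : Measure Ω} {κ : Fin d}
    {G : Orthant d × Orthant d → Ω → ℝ} (hG : IsNoise P κ G)
    (hx : ∀ k, x k ∈ Set.Ioo (0 : ℝ) 1) (α : Smoothness d) {u : ℝ} (hu : 0 ≤ u) :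
    P (exceedance x α κ G ((4 * (u + d + 1)) ^ (((d : ℝ) + 2) / 2))) ≤
      ENNReal.ofReal (2 ^ (d + 2) * Real.exp (-u ^ 2 / (2 * ∏ k, (x k * (1 - x k))⁻¹))) := by
  have hx' : ∀ k, (1 - x) k ∈ Set.Ioo (0 : ℝ) 1 := fun k =>
    ⟨sub_pos.2 (hx k).2, sub_lt_self 1 (hx k).1⟩
  have hmem₁ : boxCorner x ∈ G1 x α := boxCorner_mem_G1 (fun k => (hx k).1) α
  have hmem₂ : boxCorner (1 - x) ∈ G2 x α := boxCorner_mem_G1 (fun k => (hx' k).1) α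
  have hσ₂ : ∏ k ∈ upperCoords κ, (boxCorner (1 - x) k : ℝ)⁻¹ ≤ ∏ k, (x k * (1 - x k))⁻¹ := by
    simpa only [Pi.sub_apply, Pi.one_apply, sub_sub_cancel, mul_comm] using
      prod_inv_boxCorner_le hx' (upperCoords κ)
  refine (measure_mono ?_).trans (hG.measure_not_sectionsBounded_le hmem₁.1 hmem₂.1
    (prod_inv_boxCorner_le hx _) hσ₂ hu)
  rintro ω ⟨g₁, g₂, hopt, hlt⟩ hsec
  exact hlt.not_ge (hopt.abs_limitValue_le hsec hmem₁ (boxCorner_le_one fun k => (hx k).2)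
    hmem₂ (boxCorner_le_one fun k => (hx' k).2))

theorem exists_measure_exceedance_le (hx : ∀ k, x k ∈ Set.Ioo (0 : ℝ) 1) :
    ∃ L : ℝ, 0 < L ∧ ∀ (α : Smoothness d) (κ : Fin d) {Ω : Type u} [MeasurableSpace Ω]
      (P : Measure Ω) (G : Orthant d × Orthant d → Ω → ℝ), IsNoise P κ G → ∀ t : ℝ, 0 ≤ t →
        P (exceedance x α κ G t) ≤
          ENNReal.ofReal (L * Real.exp (-(t ^ (4 / ((d : ℝ) + 2))) / L)) := by
  have hσ : 0 < ∏ k, (x k * (1 - x k))⁻¹ :=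
    Finset.prod_pos fun k _ => inv_pos.2 (mul_pos (hx k).1 (sub_pos.2 (hx k).2))
  obtain ⟨L, hL, htail⟩ := exists_stretchedExponential_tail_bound (K := 2 ^ (d + 2)) (m := d + 1)
    (r := ((d : ℝ) + 2) / 2) (c := 4) (one_le_pow₀ one_le_two) hσ (by positivity) four_pos
  have hexponent : 2 / (((d : ℝ) + 2) / 2) = 4 / ((d : ℝ) + 2) := by
    rw [div_div_eq_mul_div]
    norm_num
  rw [hexponent] at htail
  refine ⟨L, hL, fun α κ Ω _ P G hG => ?_⟩
  have := hG.gaussian.isProbabilityMeasure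
  refine htail (fun t => P (exceedance x α κ G t)) (fun t => prob_le_one) fun u hu => ?_
  simpa only [add_assoc] using hG.measure_exceedance_le hx α hu

end Exceedance

end BlockIsotonic

theorem mainTheorem4_general {d : ℕ} (x₀ : Fin d → ℝ) (hx₀ : ∀ k, x₀ k ∈ Set.Ioo (0 : ℝ) 1) :
    (∃ L₀ : ℝ, 0 < L₀ ∧
      ∀ (α : BlockIsotonic.Smoothness d) (κ : Fin d) {Ω : Type u} [MeasurableSpace Ω]
        (P : Measure Ω) (G : BlockIsotonic.Orthant d × BlockIsotonic.Orthant d → Ω → ℝ),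
        BlockIsotonic.IsNoise P κ G →
      ∀ t : ℝ, 0 ≤ t →
        P (BlockIsotonic.exceedance x₀ α κ G t) ≤
          ENNReal.ofReal (L₀ * Real.exp (-(t ^ (4 / ((d : ℝ) + 2))) / L₀))) ∧
    (∀ δ₀ ∈ Set.Ioo (0 : ℝ) 1, ∃ C : ℝ, 0 < C ∧ ∀ δ : ℝ, 0 < δ → δ ≤ δ₀ →
      ∀ (α : BlockIsotonic.Smoothness d) (κ : Fin d) {Ω : Type u} [MeasurableSpace Ω]
        (P : Measure Ω) (G : BlockIsotonic.Orthant d × BlockIsotonic.Orthant d → Ω → ℝ),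
        BlockIsotonic.IsNoise P κ G →
        P (BlockIsotonic.exceedance x₀ α κ G
            (C * Real.log (1 / δ) ^ (((d : ℝ) + 2) / 4))) ≤ ENNReal.ofReal δ) := by
  obtain ⟨L, hL, htail⟩ := BlockIsotonic.exists_measure_exceedance_le hx₀
  refine ⟨⟨L, hL, htail⟩, fun δ₀ hδ₀ => ?_⟩
  obtain ⟨C, hC, hquantile⟩ := BlockIsotonic.exists_forall_exp_neg_le hL
    (a := 4 / ((d : ℝ) + 2)) (by positivity) hδ₀
  rw [inv_div] at hquantile
  refine ⟨C, hC, fun δ hδ hδδ₀ α κ Ω _ P G hG => ?_⟩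
  have hlog : 0 ≤ Real.log (1 / δ) := Real.log_nonneg (one_le_one_div hδ (hδδ₀.trans hδ₀.2.le))
  exact (htail α κ P G hG _ (mul_nonneg hC.le (Real.rpow_nonneg hlog _))).trans
    (ENNReal.ofReal_le_ofReal (hquantile δ hδ hδδ₀))

theorem mainTheorem4 (d : ℕ) (hd : 1 ≤ d) (x₀ : Fin d → ℝ)
    (hx₀ : ∀ k, x₀ k ∈ Set.Ioo (0 : ℝ) 1) :
    (∃ L₀ : ℝ, 0 < L₀ ∧
      ∀ (α : BlockIsotonic.Smoothness d) (D : BlockIsotonic.Design d) (κ : Fin d),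
        BlockIsotonic.IsCriticalIndex α κ D →
      ∀ {Ω : Type u} [MeasurableSpace Ω] (P : MeasureTheory.Measure Ω)
        [MeasureTheory.IsProbabilityMeasure P]
        (G : BlockIsotonic.Orthant d × BlockIsotonic.Orthant d → Ω → ℝ),
        BlockIsotonic.IsNoise P κ G →
      ∀ t : ℝ, 1 ≤ t →
        P (BlockIsotonic.exceedance x₀ α κ G t) ≤
          ENNReal.ofReal (L₀ * Real.exp (-(t ^ (4 / ((d : ℝ) + 2))) / L₀))) ∧
    (∀ δ₀ ∈ Set.Ioo (0 : ℝ) 1, ∃ C : ℝ, 0 < C ∧ ∀ δ : ℝ, 0 < δ → δ ≤ δ₀ →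
      ∀ (α : BlockIsotonic.Smoothness d) (D : BlockIsotonic.Design d) (κ : Fin d),
        BlockIsotonic.IsCriticalIndex α κ D →
      ∀ {Ω : Type u} [MeasurableSpace Ω] (P : MeasureTheory.Measure Ω)
        [MeasureTheory.IsProbabilityMeasure P]
        (G : BlockIsotonic.Orthant d × BlockIsotonic.Orthant d → Ω → ℝ),
        BlockIsotonic.IsNoise P κ G →
        P (BlockIsotonic.exceedance x₀ α κ G
            (C * Real.log (1 / δ) ^ (((d : ℝ) + 2) / 4))) ≤ ENNReal.ofReal δ) := by
  obtain ⟨⟨L, hL, htail⟩, hquantile⟩ := mainTheorem4_general x₀ hx₀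
  exact ⟨⟨L, hL, fun α _ κ _ _ _ P _ G hG t ht => htail α κ P G hG t (zero_le_one.trans ht)⟩,
    fun δ₀ hδ₀ => (hquantile δ₀ hδ₀).imp fun _ ⟨hC, hδ⟩ =>
      ⟨hC, fun δ h h' α _ κ _ _ _ P _ => hδ δ h h' α κ P⟩⟩
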